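/- **Theorem (soundness and completeness of parallel AC-6-based trimming).** Let $G=(V,E)$ be a finite directed graph (self-loops allowed), let $v.\mathit{post}=\{w\mid (v,w)\in E\}$, and let $\mathcal P\ge 1$ be the number of workers. Consider the following shared-memory algorithm. Shared between the workers are, for every vertex $v$, its supporting set $v.S\subseteq V$, its $v.\mathit{status}\in\{\mathtt{LIVE},\mathtt{DEAD}\}$ and a Boolean $v.\mathit{lock}$; private to each worker $p$ is a waiting set $Q_p\subseteq V$. - *Main program.* For every $v\in V$: $v.S:=\emptyset$, $v.\mathit{status}:=\mathtt{LIVE}$, $\mathtt{Unlock}(v)$. Then partition $V$ into (possibly empty) blocks $V_1,\dots,V_{\mathcal P}$, run $\mathtt{Trim}_1(V_1)\parallel\dots\parallel\mathtt{Trim}_{\mathcal P}(V_{\mathcal P})$, and terminate when all workers have terminated. - $\mathtt{Trim}_p(V_p)$: for each $v\in V_p$: set $Q_p:=\emptyset$ and call $\mathtt{DoPost}_p(v,Q_p)$; then, while $Q_p\ne\emptyset$: remove some $w$ from $Q_p$ and, for each $v'\in w.S$, do $w.S:=w.S\setminus\{v'\}$ and call $\mathtt{DoPost}_p(v',Q_p)$.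 - $\mathtt{DoPost}_p(v,Q_p)$: for each $w\in v.\mathit{post}$ whose status is read as $\mathtt{LIVE}$ when the loop reaches it: $\mathtt{Lock}(w)$; if (still) $w.\mathit{status}=\mathtt{LIVE}$, then $w.S:=w.S\cup\{v\}$, $\mathtt{Unlock}(w)$ and return; otherwise $\mathtt{Unlock}(w)$ and continue the loop. If the loop ends without a return: $\mathtt{Lock}(v)$; $v.\mathit{status}:=\mathtt{DEAD}$; $\mathtt{Unlock}(v)$; $Q_p:=Q_p\cup\{v\}$. - $\mathtt{Lock}(w)$: repeat the atomic operation $\mathtt{CAS}(w.\mathit{lock},\mathtt{FALSE},\mathtt{TRUE})$ until it succeeds (busy waiting). $\mathtt{Unlock}(w)$: $w.\mathit{lock}:=\mathtt{FALSE}$. The execution is an arbitrary interleaving of the threads over a sequentially consistent memory: after the initialisation, each single read, write or $\mathtt{CAS}$ of a shared variable is one atomic step (so the updates $w.S:=w.S\cup\{v\}$ and $w.S:=w.S\setminus\{v'\}$ consist of a separate read and write). The initial contents of the memory, the partition, the iteration orders of all loops, and the choice of the vertex removed from $Q_p$ are arbitrary. Write $$\mathit{sound}(V):\ \forall v\in V:\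 v.\mathit{status}=\mathtt{DEAD}\Rightarrow(\forall w\in v.\mathit{post}:\ w.\mathit{status}=\mathtt{DEAD}),$$ $$\mathit{complete}(V):\ \forall v\in V:\ (\forall w\in v.\mathit{post}:\ w.\mathit{status}=\mathtt{DEAD})\Rightarrow v.\mathit{status}=\mathtt{DEAD}.$$ Then the algorithm terminates with $\mathit{sound}(V)$ and $\mathit{complete}(V)$: every weakly fair execution (one in which no thread that can make a step is neglected forever; a failed $\mathtt{CAS}$ counts as a step) reaches termination after finitely many steps, and in every execution, fair or not, $\mathit{sound}(V)\wedge\mathit{complete}(V)$ holds whenever the algorithm has terminated. -/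

import Mathlib

namespace AC6

/-- The status of a vertex. -/
inductive Status where
  | live
  | dead

/-- `v.post`, the set of successors of `v`. -/
noncomputable def post {V : Type*} [Fintype V] (G : Digraph V) (v : V) : Finset V := by
  classical exact Finset.univ.filter (fun w => G.Adj v w)

/-- `sound(V)`: every dead vertex has only dead successors. -/
def Sound {V : Type*} [Fintype V] (G : Digraph V) (status : V → Status) : Prop :=
  ∀ v : V, status v = Status.dead → ∀ w ∈ post G v, status w = Status.dead

/-- `complete(V)`: every vertex all of whose successors are dead is dead. -/
def Complete {V : Type*} [Fintype V] (G : Digraph V) (status : V → Status) : Prop :=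
  ∀ v : V, (∀ w ∈ post G v, status w = Status.dead) → status v = Status.dead

/-- The shared memory: for each vertex `v` the supporting set `v.S`, the status `v.status` and the
Boolean lock variable `v.lock`. -/
structure Memory (V : Type*) where
  S : V → Finset V
  status : V → Status
  lock : V → Bool

namespace Memory

variable {V : Type*} [DecidableEq V]

/-- The assignment `v.S := X`. -/
def setS (m : Memory V) (v : V) (X : Finset V) : Memory V :=
  { m with S := Function.update m.S v X }

/-- The assignment `v.status := s`. -/
def setStatus (m : Memory V) (v : V) (s : Status) : Memory V :=
  { m with status := Function.update m.status v s }

/-- The assignment `v.lock := b`. -/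
def setLock (m : Memory V) (v : V) (b : Bool) : Memory V :=
  { m with lock := Function.update m.lock v b }

end Memory

/-- The two places from which `DoPost` is called, which is where the worker continues afterwards:
the visit of a vertex by the outer for-loop (it continues at the head of the while-loop), or the
loop `for v' ∈ w.S` (it continues at the head of that loop). -/
inductive Caller (V : Type*) where
  | visit
  | prop (w : V)

/-- The program counter of a worker, together with the local variables alive at that point.
In `DoPost(v)`, the argument `R` is the set of the successors of `v` over which the loop
`for w ∈ v.post with w.status = LIVE` has not iterated yet, and `k` is the caller. -/
inductive Ctrl (V : Type*) where
  /-- The worker has not been started yet. -/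
  | idle
  /-- Head of `for v ∈ V_p`. -/
  | outerLoop
  /-- Head of `while Q_p ≠ ∅`. -/
  | whileLoop
  /-- Head of `for v' ∈ w.S`. -/
  | suppLoop (w : V)
  /-- About to read `w.S` in `w.S := w.S \ {v'}`. -/
  | removeRead (w v' : V)
  /-- About to write in `w.S := w.S \ {v'}`; the value `X` of `w.S` has been read. -/
  | removeWrite (w v' : V) (X : Finset V)
  /-- `DoPost(v)`: head of `for w ∈ v.post with w.status = LIVE`. -/
  | scan (v : V) (R : Finset V) (k : Caller V)
  /-- `DoPost(v)`: executing `Lock(w)`. -/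
  | lockSucc (v : V) (R : Finset V) (w : V) (k : Caller V)
  /-- `DoPost(v)`: at the test `if w.status = LIVE`, holding the lock of `w`. -/
  | recheck (v : V) (R : Finset V) (w : V) (k : Caller V)
  /-- `DoPost(v)`: about to read `w.S` in `w.S := w.S ∪ {v}`. -/
  | addRead (v : V) (w : V) (k : Caller V)
  /-- `DoPost(v)`: about to write in `w.S := w.S ∪ {v}`; the value `X` of `w.S` has been read. -/
  | addWrite (v : V) (w : V) (X : Finset V) (k : Caller V)
  /-- `DoPost(v)`: at `Unlock(w); return`. -/
  | unlockReturn (v : V) (w : V) (k : Caller V)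
  /-- `DoPost(v)`: at the `Unlock(w)` after which the loop over `v.post` goes on. -/
  | unlockNext (v : V) (R : Finset V) (w : V) (k : Caller V)
  /-- `DoPost(v)`: the loop is exhausted; executing `Lock(v)`. -/
  | lockSelf (v : V) (k : Caller V)
  /-- `DoPost(v)`: at `v.status := DEAD`. -/
  | kill (v : V) (k : Caller V)
  /-- `DoPost(v)`: at `Unlock(v)`. -/
  | unlockSelf (v : V) (k : Caller V)
  /-- `DoPost(v)`: at `Q_p := Q_p ∪ {v}`. -/
  | enqueue (v : V) (k : Caller V)
  /-- The worker has terminated. -/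
  | finished

/-- The control point after a return from `DoPost`. -/
def Caller.resume {V : Type*} : Caller V → Ctrl V
  | Caller.visit => Ctrl.whileLoop
  | Caller.prop w => Ctrl.suppLoop w

/-- The private state of a worker `p`: the vertices of `V_p` not yet visited by its outer for-loop,
its private waiting set `Q_p`, and its program counter. -/
structure Worker (V : Type*) where
  todo : Finset V
  Q : Finset V
  ctrl : Ctrl V

/-- One atomic step of a worker. Every step makes at most one access (a read, a write or a `CAS`)
to the shared memory. -/
inductive WorkerStep {V : Type*} [Fintype V] [DecidableEq V] (G : Digraph V) :
    Memory V → Worker V → Memory V → Worker V → Prop where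
  /- procedure `Trim_p(V_p)` -/
  | outer_next (m : Memory V) (T Q : Finset V) (v : V) (hv : v ∈ T) :
      WorkerStep G m ⟨T, Q, Ctrl.outerLoop⟩
        m ⟨T.erase v, ∅, Ctrl.scan v (post G v) Caller.visit⟩
  | outer_exit (m : Memory V) (Q : Finset V) :
      WorkerStep G m ⟨∅, Q, Ctrl.outerLoop⟩ m ⟨∅, Q, Ctrl.finished⟩
  | while_next (m : Memory V) (T Q : Finset V) (w : V) (hw : w ∈ Q) :
      WorkerStep G m ⟨T, Q, Ctrl.whileLoop⟩ m ⟨T, Q.erase w, Ctrl.suppLoop w⟩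
  | while_exit (m : Memory V) (T : Finset V) :
      WorkerStep G m ⟨T, ∅, Ctrl.whileLoop⟩ m ⟨T, ∅, Ctrl.outerLoop⟩
  | supp_next (m : Memory V) (T Q : Finset V) (w v' : V) (hv' : v' ∈ m.S w) :
      WorkerStep G m ⟨T, Q, Ctrl.suppLoop w⟩ m ⟨T, Q, Ctrl.removeRead w v'⟩
  | supp_exit (m : Memory V) (T Q : Finset V) (w : V) (hw : m.S w = ∅) :
      WorkerStep G m ⟨T, Q, Ctrl.suppLoop w⟩ m ⟨T, Q, Ctrl.whileLoop⟩
  | remove_read (m : Memory V) (T Q : Finset V) (w v' : V) :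
      WorkerStep G m ⟨T, Q, Ctrl.removeRead w v'⟩ m ⟨T, Q, Ctrl.removeWrite w v' (m.S w)⟩
  | remove_write (m : Memory V) (T Q : Finset V) (w v' : V) (X : Finset V) :
      WorkerStep G m ⟨T, Q, Ctrl.removeWrite w v' X⟩
        (m.setS w (X.erase v')) ⟨T, Q, Ctrl.scan v' (post G v') (Caller.prop w)⟩
  /- procedure `DoPost_p(v, Q_p)`: looking for a live successor -/
  | scan_live (m : Memory V) (T Q : Finset V) (v : V) (R : Finset V) (w : V) (k : Caller V)
      (hw : w ∈ R) (hl : m.status w = Status.live) :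
      WorkerStep G m ⟨T, Q, Ctrl.scan v R k⟩ m ⟨T, Q, Ctrl.lockSucc v (R.erase w) w k⟩
  | scan_dead (m : Memory V) (T Q : Finset V) (v : V) (R : Finset V) (w : V) (k : Caller V)
      (hw : w ∈ R) (hd : m.status w = Status.dead) :
      WorkerStep G m ⟨T, Q, Ctrl.scan v R k⟩ m ⟨T, Q, Ctrl.scan v (R.erase w) k⟩
  | scan_exit (m : Memory V) (T Q : Finset V) (v : V) (k : Caller V) :
      WorkerStep G m ⟨T, Q, Ctrl.scan v ∅ k⟩ m ⟨T, Q, Ctrl.lockSelf v k⟩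
  | lockSucc_fail (m : Memory V) (T Q : Finset V) (v : V) (R : Finset V) (w : V) (k : Caller V)
      (hb : m.lock w = true) :
      WorkerStep G m ⟨T, Q, Ctrl.lockSucc v R w k⟩ m ⟨T, Q, Ctrl.lockSucc v R w k⟩
  | lockSucc_ok (m : Memory V) (T Q : Finset V) (v : V) (R : Finset V) (w : V) (k : Caller V)
      (hb : m.lock w = false) :
      WorkerStep G m ⟨T, Q, Ctrl.lockSucc v R w k⟩
        (m.setLock w true) ⟨T, Q, Ctrl.recheck v R w k⟩
  | recheck_live (m : Memory V) (T Q : Finset V) (v : V) (R : Finset V) (w : V) (k : Caller V)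
      (hl : m.status w = Status.live) :
      WorkerStep G m ⟨T, Q, Ctrl.recheck v R w k⟩ m ⟨T, Q, Ctrl.addRead v w k⟩
  | recheck_dead (m : Memory V) (T Q : Finset V) (v : V) (R : Finset V) (w : V) (k : Caller V)
      (hd : m.status w = Status.dead) :
      WorkerStep G m ⟨T, Q, Ctrl.recheck v R w k⟩ m ⟨T, Q, Ctrl.unlockNext v R w k⟩
  | add_read (m : Memory V) (T Q : Finset V) (v w : V) (k : Caller V) :
      WorkerStep G m ⟨T, Q, Ctrl.addRead v w k⟩ m ⟨T, Q, Ctrl.addWrite v w (m.S w) k⟩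
  | add_write (m : Memory V) (T Q : Finset V) (v w : V) (X : Finset V) (k : Caller V) :
      WorkerStep G m ⟨T, Q, Ctrl.addWrite v w X k⟩
        (m.setS w (insert v X)) ⟨T, Q, Ctrl.unlockReturn v w k⟩
  | unlock_return (m : Memory V) (T Q : Finset V) (v w : V) (k : Caller V) :
      WorkerStep G m ⟨T, Q, Ctrl.unlockReturn v w k⟩ (m.setLock w false) ⟨T, Q, k.resume⟩
  | unlock_next (m : Memory V) (T Q : Finset V) (v : V) (R : Finset V) (w : V) (k : Caller V) :
      WorkerStep G m ⟨T, Q, Ctrl.unlockNext v R w k⟩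
        (m.setLock w false) ⟨T, Q, Ctrl.scan v R k⟩
  /- procedure `DoPost_p(v, Q_p)`: no live successor was found -/
  | lockSelf_fail (m : Memory V) (T Q : Finset V) (v : V) (k : Caller V)
      (hb : m.lock v = true) :
      WorkerStep G m ⟨T, Q, Ctrl.lockSelf v k⟩ m ⟨T, Q, Ctrl.lockSelf v k⟩
  | lockSelf_ok (m : Memory V) (T Q : Finset V) (v : V) (k : Caller V)
      (hb : m.lock v = false) :
      WorkerStep G m ⟨T, Q, Ctrl.lockSelf v k⟩ (m.setLock v true) ⟨T, Q, Ctrl.kill v k⟩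
  | kill (m : Memory V) (T Q : Finset V) (v : V) (k : Caller V) :
      WorkerStep G m ⟨T, Q, Ctrl.kill v k⟩
        (m.setStatus v Status.dead) ⟨T, Q, Ctrl.unlockSelf v k⟩
  | unlock_self (m : Memory V) (T Q : Finset V) (v : V) (k : Caller V) :
      WorkerStep G m ⟨T, Q, Ctrl.unlockSelf v k⟩ (m.setLock v false) ⟨T, Q, Ctrl.enqueue v k⟩
  | enqueue (m : Memory V) (T Q : Finset V) (v : V) (k : Caller V) :
      WorkerStep G m ⟨T, Q, Ctrl.enqueue v k⟩ m ⟨T, insert v Q, k.resume⟩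

/-- The program counter of the main thread: initialising (with the set of vertices not yet
initialised), waiting for all workers to terminate, or terminated. -/
inductive MainCtrl (V : Type*) where
  | init (todo : Finset V)
  | join
  | done

/-- A global state of the algorithm with `P` workers. -/
structure Config (V : Type*) (P : ℕ) where
  mem : Memory V
  main : MainCtrl V
  worker : Fin P → Worker V

/-- The threads: `none` is the main thread, `some p` is the worker `p`. -/
abbrev Thread (P : ℕ) := Option (Fin P)

/-- One atomic step of a thread. The main thread initialises all vertices one by one, then chooses
an arbitrary partition of the vertices into `P` (possibly empty) blocks, where `part v` is the block
of `v`, and starts the `P` workers, and finally waits for all of them. -/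
inductive Step {V : Type*} [Fintype V] [DecidableEq V] {P : ℕ} (G : Digraph V) :
    Thread P → Config V P → Config V P → Prop where
  | init_next (m : Memory V) (W : Fin P → Worker V) (T : Finset V) (v : V) (hv : v ∈ T) :
      Step G none ⟨m, MainCtrl.init T, W⟩
        ⟨((m.setS v ∅).setStatus v Status.live).setLock v false, MainCtrl.init (T.erase v), W⟩
  | fork (m : Memory V) (W : Fin P → Worker V) (part : V → Fin P) :
      Step G none ⟨m, MainCtrl.init ∅, W⟩
        ⟨m, MainCtrl.join,
          fun p => ⟨Finset.univ.filter (fun v => part v = p), ∅, Ctrl.outerLoop⟩⟩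
  | join (m : Memory V) (W : Fin P → Worker V) (hW : ∀ p, (W p).ctrl = Ctrl.finished) :
      Step G none ⟨m, MainCtrl.join, W⟩ ⟨m, MainCtrl.done, W⟩
  | work (m m' : Memory V) (c : MainCtrl V) (W : Fin P → Worker V) (p : Fin P) (w' : Worker V)
      (h : WorkerStep G m (W p) m' w') :
      Step G (some p) ⟨m, c, W⟩ ⟨m', c, Function.update W p w'⟩

/-- Initial states: nothing is assumed about the contents of the shared memory. -/
def Config.IsInitial {V : Type*} [Fintype V] {P : ℕ} (c : Config V P) : Prop :=
  c.main = MainCtrl.init Finset.univ ∧ ∀ p, c.worker p = ⟨∅, ∅, Ctrl.idle⟩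

/-- The algorithm has terminated. -/
def Config.Terminated {V : Type*} {P : ℕ} (c : Config V P) : Prop :=
  c.main = MainCtrl.done

/-- Thread `t` can make a step in state `c`. -/
def Enabled {V : Type*} [Fintype V] [DecidableEq V] {P : ℕ} (G : Digraph V) (t : Thread P)
    (c : Config V P) : Prop :=
  ∃ c', Step G t c c'

/-- `c` is a run of the algorithm under the schedule `σ`: at each time `i` the thread `σ i` makes
one step; if it cannot make one (it has not been started, has terminated, or is the main thread
waiting for the workers), then nothing happens. -/
def IsRun {V : Type*} [Fintype V] [DecidableEq V] {P : ℕ} (G : Digraph V) (σ : ℕ → Thread P)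
    (c : ℕ → Config V P) : Prop :=
  (c 0).IsInitial ∧
    ∀ i, Step G (σ i) (c i) (c (i + 1)) ∨ (¬ Enabled G (σ i) (c i) ∧ c (i + 1) = c i)

/-- Weak fairness: every thread is infinitely often scheduled or infinitely often unable to make a
step, so no thread that can make a step is neglected forever. -/
def WeaklyFair {V : Type*} [Fintype V] [DecidableEq V] {P : ℕ} (G : Digraph V)
    (σ : ℕ → Thread P) (c : ℕ → Config V P) : Prop :=
  ∀ t : Thread P, ∀ i, ∃ j, i ≤ j ∧ (σ j = t ∨ ¬ Enabled G t (c j))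

end AC6

/-!
The proof is a rely/guarantee argument. Every vertex `v` is at each moment in exactly one of three
situations: exactly one worker still has to decide about it (`Worker.Pending`), or it is an element
of exactly one supporting set, or it is dead. As long as the supporting set of a dead vertex is not
empty, exactly one worker is in charge of emptying it (`Worker.Owns`). The lock of `w`, together
with the second test of `w.status`, ensures that elements are inserted into `w.S` only while `w` is
live and locked; once `w` is dead only the worker that killed it writes to `w.S`. Hence the separate
read and write of `w.S` never lose an update, and two workers never run `DoPost` on the same vertex
at the same time. The invariant consists of assertions about the memory (`MemoryInv`), about a single worker
(`WorkerInv`), and about pairs of workers (`Compatible`), and of the statement that no vertex and no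
lock gets lost (`Inv`). `WorkerInv.guarantee` collects what one step may change, and
`WorkerInv.interference` deduces that it does not disturb the other workers.

Soundness is a part of the invariant: `DoPost v` kills `v` only after each successor of `v` was seen
to be dead, and dead vertices stay dead. For completeness (`Inv.complete`), when all workers have
terminated no vertex is pending or owned, so that a live vertex is an element of `w.S` for one of
its successors `w`, and `w` is live because the supporting sets of the dead vertices are empty.

For termination, every kill lowers the number of live vertices, and every repeated call of `DoPost`
is preceded by a removal from the supporting set of a dead vertex, which never grows again.
This gives a natural number that decreases in every step except for a failed `CAS`, which changes
nothing (`Config.Inv.step`). So every run is eventually constant. In a constant state before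
termination some thread can make a step, and only steps that change the state
(`Config.Inv.exists_enabled`): the holder of a lock if there is one; otherwise no worker is kept
waiting by a `CAS`. This contradicts weak fairness.
-/

namespace AC6

/-! ### The invariant of memory and worker -/

section

variable {V : Type*}

/-- The vertices whose lock is held at a control point. -/
def Ctrl.Holds : Ctrl V → V → Prop
  | recheck _ _ w _, u | addRead _ w _, u | addWrite _ w _ _, u | unlockReturn _ w _, u
  | unlockNext _ _ w _, u => u = w
  | kill v _, u | unlockSelf v _, u => u = v
  | _, _ => False

/-- The vertices `v` for which a call `DoPost(v)` is running and has not yet decided the fate of `v`,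
that is, has neither inserted `v` into a supporting set nor declared `v` dead. -/
def Ctrl.Processing : Ctrl V → V → Prop
  | scan v _ _, u | lockSucc v _ _ _, u | recheck v _ _ _, u | addRead v _ _, u
  | addWrite v _ _ _, u | unlockNext v _ _ _, u | lockSelf v _, u | kill v _, u => u = v
  | _, _ => False

/-- The vertex whose supporting set is being emptied by the caller of `DoPost`. -/
def Caller.Propagating : Caller V → V → Prop
  | visit, _ => False
  | prop w, u => u = w

/-- The dead vertices in the hands of a worker at a control point, outside its waiting set: the one
whose supporting set it is emptying, and one that it has killed but not yet put into the waiting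
set. -/
def Ctrl.Propagating : Ctrl V → V → Prop
  | suppLoop w, u | removeRead w _, u | removeWrite w _ _, u => u = w
  | scan _ _ k, u | lockSucc _ _ _ k, u | recheck _ _ _ k, u | addRead _ _ k, u
  | addWrite _ _ _ k, u | unlockReturn _ _ k, u | unlockNext _ _ _ k, u | lockSelf _ k, u
  | kill _ k, u => k.Propagating u
  | unlockSelf v k, u | enqueue v k, u => u = v ∨ k.Propagating u
  | _, _ => False

/-- The vertex `v` awaits a decision by the worker: its visit is still to come, or `DoPost(v)` is
running. -/
def Worker.Pending (w : Worker V) (v : V) : Prop :=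
  v ∈ w.todo ∨ w.ctrl.Processing v

/-- The worker is responsible for emptying the supporting set of the dead vertex `v`. -/
def Worker.Owns (w : Worker V) (v : V) : Prop :=
  v ∈ w.Q ∨ w.ctrl.Propagating v

variable [Fintype V]

/-- The assertion about the shared memory that a worker relies on at a control point. In particular
a value read from a supporting set is still current when it is written back, and every successor
that `DoPost` has passed over is dead. -/
def Ctrl.Assertion (G : Digraph V) (m : Memory V) : Ctrl V → Prop
  | idle => False
  | removeRead w v' => v' ∈ m.S w
  | removeWrite w v' X => v' ∈ m.S w ∧ X = m.S w
  | scan v R _ | unlockNext v R _ _ =>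
      R ⊆ post G v ∧ ∀ u ∈ post G v, u ∉ R → m.status u = Status.dead
  | lockSucc v R w _ => w ∈ post G v ∧ R ⊆ post G v ∧
      ∀ u ∈ post G v, u ∉ R → u = w ∨ m.status u = Status.dead
  | recheck v R w _ => w ∈ post G v ∧ R ⊆ post G v ∧
      ∀ u ∈ post G v, u ∉ R → u = w ∨ m.status u = Status.dead
  | addRead v w _ => w ∈ post G v ∧ m.status w = Status.live
  | addWrite v w X _ => w ∈ post G v ∧ m.status w = Status.live ∧ X = m.S w
  | lockSelf v _ | kill v _ => ∀ u ∈ post G v, m.status u = Status.dead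
  | _ => True

/-- The part of the invariant that concerns the shared memory only. -/
structure MemoryInv (G : Digraph V) (m : Memory V) : Prop where
  edge : ∀ v w, v ∈ m.S w → w ∈ post G v
  live : ∀ v w, v ∈ m.S w → m.status v = Status.live
  unique : ∀ v w w', v ∈ m.S w → v ∈ m.S w' → w = w'
  sound : Sound G m.status

/-- The part of the invariant that relates one worker to the shared memory. -/
structure WorkerInv (G : Digraph V) (m : Memory V) (w : Worker V) : Prop where
  assertion : w.ctrl.Assertion G m
  queue : w.ctrl = Ctrl.outerLoop ∨ w.ctrl = Ctrl.finished → w.Q = ∅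
  todo : w.ctrl = Ctrl.finished → w.todo = ∅
  disjoint : ∀ v ∈ w.todo, ¬ w.ctrl.Processing v
  locked : ∀ u, w.ctrl.Holds u → m.lock u = true
  live : ∀ v, w.Pending v → m.status v = Status.live
  fresh : ∀ v, w.Pending v → ∀ u, v ∉ m.S u
  dead : ∀ v, w.Owns v → m.status v = Status.dead

/-- Two workers hold no lock in common and are responsible for different vertices. -/
structure Compatible (w₁ w₂ : Worker V) : Prop where
  holds : ∀ u, w₁.ctrl.Holds u → ¬ w₂.ctrl.Holds u
  pending : ∀ v, w₁.Pending v → ¬ w₂.Pending v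
  owns : ∀ v, w₁.Owns v → ¬ w₂.Owns v

variable [DecidableEq V] {G : Digraph V} {m m' : Memory V} {w w' w₂ : Worker V}

theorem WorkerInv.step (h : WorkerStep G m w m' w') (hm : MemoryInv G m) (hw : WorkerInv G m w) :
    WorkerInv G m' w' := by
  obtain ⟨a1, a2, a3, a4, a5, a6, a7, a8⟩ := hw
  obtain ⟨b1, b2, b3, b4⟩ := hm
  cases h
  all_goals try rename Caller V => k; cases k
  all_goals
    simp only [Ctrl.Assertion, Worker.Pending, Worker.Owns, Ctrl.Holds, Ctrl.Processing,
      Ctrl.Propagating, Caller.Propagating] at a1 a2 a3 a4 a5 a6 a7 a8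
    constructor <;>
      simp only [Ctrl.Assertion, Worker.Pending, Worker.Owns, Ctrl.Holds, Ctrl.Processing,
        Ctrl.Propagating, Caller.Propagating, Caller.resume, Memory.setS, Memory.setStatus,
        Memory.setLock, Function.update_apply] <;> grind

theorem MemoryInv.step (h : WorkerStep G m w m' w') (hm : MemoryInv G m) (hw : WorkerInv G m w) :
    MemoryInv G m' := by
  obtain ⟨a1, -, -, -, -, a6, a7, a8⟩ := hw
  cases h
  case add_write | remove_write | kill =>
    obtain ⟨b1, b2, b3, b4⟩ := hm
    simp only [Ctrl.Assertion, Worker.Pending, Worker.Owns, Ctrl.Processing,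
      Ctrl.Propagating] at a1 a6 a7 a8
    constructor <;>
      simp only [Sound, Memory.setS, Memory.setStatus, Function.update_apply] at * <;> grind
  -- The other steps change neither a supporting set nor a status.
  all_goals exact ⟨hm.edge, hm.live, hm.unique, hm.sound⟩

end

/-! ### Non-interference -/

section

variable {V : Type*} {m m' : Memory V} {w w' w₂ : Worker V}

/-- What the step of a worker from `(m, w)` to `(m', w')` may do to the shared memory and to the
resources (locks and vertices) held by the worker. This is all that the other workers need to know
about the step. -/
structure Guarantee (m : Memory V) (w : Worker V) (m' : Memory V) (w' : Worker V) : Prop where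
  dead : ∀ u, m.status u = Status.dead → m'.status u = Status.dead
  status : ∀ u, m'.status u ≠ m.status u → w.ctrl.Holds u ∧ w.Pending u
  support : ∀ u, m'.S u ≠ m.S u → (w.ctrl.Holds u ∧ m.status u = Status.live) ∨ w.Owns u
  mem_support : ∀ v u, v ∈ m'.S u → v ∈ m.S u ∨ w.Pending v
  support_empty : ∀ u, m.status u = Status.dead → m.S u = ∅ → m'.S u = ∅
  lock : ∀ u, m.lock u = true → m'.lock u = true ∨ w.ctrl.Holds u
  holds : ∀ u, w'.ctrl.Holds u → w.ctrl.Holds u ∨ m.lock u = false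
  pending : ∀ v, w'.Pending v → w.Pending v ∨ ∃ u, v ∈ m.S u
  owns : ∀ v, w'.Owns v → w.Owns v ∨ w.Pending v
  locked : ∀ u, m'.lock u = true → w'.ctrl.Holds u ∨ (m.lock u = true ∧ ¬ w.ctrl.Holds u)
  covered_live : ∀ v, w.Pending v ∨ (∃ u, v ∈ m.S u) → m'.status v = Status.live →
    w'.Pending v ∨ ∃ u, v ∈ m'.S u
  covered_dead : ∀ v, w.Owns v ∨ m.status v = Status.live → m'.status v = Status.dead →
    w'.Owns v ∨ m'.S v = ∅

theorem Compatible.symm (h : Compatible w w₂) : Compatible w₂ w :=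
  ⟨fun u h₁ h₂ => h.holds u h₂ h₁, fun u h₁ h₂ => h.pending u h₂ h₁,
    fun u h₁ h₂ => h.owns u h₂ h₁⟩

variable [Fintype V] {G : Digraph V}

theorem Compatible.step (g : Guarantee m w m' w') (hw : WorkerInv G m w)
    (hw₂ : WorkerInv G m w₂) (hc : Compatible w w₂) : Compatible w' w₂ where
  holds u h h₂ := (g.holds u h).elim (fun h => hc.holds u h h₂) fun h => by
    simp [hw₂.locked u h₂] at h
  pending v h h₂ := (g.pending v h).elim (fun h => hc.pending v h h₂) fun ⟨u, hu⟩ =>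
    hw₂.fresh v h₂ u hu
  owns v h h₂ := (g.owns v h).elim (fun h => hc.owns v h h₂) fun h => by
    simpa [hw.live v h] using hw₂.dead v h₂

variable [DecidableEq V]

set_option maxHeartbeats 1000000 in
theorem WorkerInv.guarantee (h : WorkerStep G m w m' w') (hw : WorkerInv G m w) :
    Guarantee m w m' w' := by
  obtain ⟨a1, a2, a3, a4, a5, a6, a7, a8⟩ := hw
  cases h
  all_goals try rename Caller V => k; cases k
  all_goals
    simp only [Ctrl.Assertion, Worker.Pending, Worker.Owns, Ctrl.Holds, Ctrl.Processing,
      Ctrl.Propagating, Caller.Propagating] at a1 a2 a3 a4 a5 a6 a7 a8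
    constructor <;>
      try simp only [Worker.Pending, Worker.Owns, Ctrl.Holds, Ctrl.Processing,
        Ctrl.Propagating, Caller.Propagating, Caller.resume, Memory.setS, Memory.setStatus,
        Memory.setLock, Function.update_apply]
    all_goals grind

/-- A step of one worker preserves the invariant of any other worker compatible with it. -/
theorem WorkerInv.interference (g : Guarantee m w m' w') (hw : WorkerInv G m w)
    (hw₂ : WorkerInv G m w₂) (hc : Compatible w w₂) : WorkerInv G m' w₂ := by
  -- The status of a vertex changes only under its lock, so `w₂` can rely on its second test of
  -- the status.
  have hlive : ∀ u, w₂.ctrl.Holds u → m.status u = Status.live → m'.status u = Status.live := by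
    intro u hu hl
    by_contra hne
    exact hc.holds u (g.status u fun h => hne (h.trans hl)).1 hu
  -- Neither a live vertex locked by `w₂` nor a dead one owned by `w₂` is written to.
  have hS : ∀ u, w₂.ctrl.Holds u ∧ m.status u = Status.live ∨ w₂.Owns u → m'.S u = m.S u := by
    intro u hu
    by_contra hne
    rcases g.support u hne with ⟨h1, h2⟩ | h1 <;> rcases hu with ⟨h3, h4⟩ | h3
    · exact hc.holds u h1 h3
    · simpa [h2] using hw₂.dead u h3
    · simpa [h4] using hw.dead u h1
    · exact hc.owns u h1 h3
  have gd := g.dead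
  refine ⟨?_, hw₂.queue, hw₂.todo, hw₂.disjoint, ?_, ?_, ?_, fun v hv => gd v (hw₂.dead v hv)⟩
  · have ha := hw₂.assertion
    obtain ⟨T, Q, c⟩ := w₂
    cases c <;>
      simp only [Ctrl.Assertion, Worker.Owns, Ctrl.Holds, Ctrl.Propagating] at * <;> grind
  · intro u hu
    exact (g.lock u (hw₂.locked u hu)).resolve_right fun h => hc.holds u h hu
  · intro v hv
    by_contra hne
    exact hc.pending v (g.status v fun h => hne (h.trans (hw₂.live v hv))).2 hv
  · intro v hv u hu
    exact (g.mem_support v u hu).elim (hw₂.fresh v hv u) fun h => hc.pending v h hv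

end

/-! ### The invariant of the parallel phase -/

section

variable {V : Type*} [Fintype V] {G : Digraph V} {m m' : Memory V}
  {w w' w₂ : Worker V} {P : ℕ} {W : Fin P → Worker V}

/-- The invariant of the parallel phase. The last three fields say that nothing gets lost: a locked
lock is held by a worker, a live vertex awaits a decision or is in a supporting set, and a dead
vertex has an empty supporting set or a worker that is going to empty it. -/
structure Inv (G : Digraph V) (m : Memory V) (W : Fin P → Worker V) : Prop where
  memory : MemoryInv G m
  worker : ∀ p, WorkerInv G m (W p)
  compatible : ∀ p q, p ≠ q → Compatible (W p) (W q)
  locked : ∀ u, m.lock u = true → ∃ p, (W p).ctrl.Holds u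
  live : ∀ v, m.status v = Status.live → (∃ p, (W p).Pending v) ∨ ∃ u, v ∈ m.S u
  dead : ∀ v, m.status v = Status.dead → (∃ p, (W p).Owns v) ∨ m.S v = ∅

theorem Inv.fork {part : V → Fin P} (hS : ∀ v, m.S v = ∅)
    (hs : ∀ v, m.status v = Status.live) (hl : ∀ v, m.lock v = false) :
    Inv G m fun p => ⟨Finset.univ.filter (fun v => part v = p), ∅, Ctrl.outerLoop⟩ where
  memory := ⟨by simp [hS], by simp [hS], by simp [hS], by simp [Sound, hs]⟩
  worker p := by
    constructor <;> simp [Ctrl.Assertion, Ctrl.Processing, Ctrl.Holds, Worker.Owns,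
      Ctrl.Propagating, hs, hS]
  compatible p q hpq := by
    constructor <;> simp [Ctrl.Processing, Ctrl.Holds, Worker.Owns, Worker.Pending,
      Ctrl.Propagating]
    rintro v rfl
    exact hpq
  locked u hu := by simp [hl] at hu
  live v _ := Or.inl ⟨part v, by simp [Worker.Pending]⟩
  dead v _ := Or.inr (hS v)

/-- When all workers have terminated, every live vertex is in the supporting set of a vertex that is
itself live, because the supporting sets of dead vertices have been emptied. -/
theorem Inv.complete (h : Inv G m W) (hf : ∀ p, (W p).ctrl = Ctrl.finished) :
    Complete G m.status := by
  have hpend : ∀ p v, ¬ (W p).Pending v := fun p v => by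
    simp [Worker.Pending, (h.worker p).todo (hf p), hf p, Ctrl.Processing]
  have howns : ∀ p v, ¬ (W p).Owns v := fun p v => by
    simp [Worker.Owns, (h.worker p).queue (Or.inr (hf p)), hf p, Ctrl.Propagating]
  intro v hv
  cases hs : m.status v with
  | dead => rfl
  | live =>
    obtain ⟨p, hp⟩ | ⟨u, hu⟩ := h.live v hs
    · exact absurd hp (hpend p v)
    · obtain ⟨p, hp⟩ | he := h.dead u (hv u (h.memory.edge v u hu))
      · exact absurd hp (howns p u)
      · simp [he] at hu

variable [DecidableEq V]

theorem Inv.step {p : Fin P} (h : Inv G m W) (hs : WorkerStep G m (W p) m' w') :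
    Inv G m' (Function.update W p w') := by
  have g := (h.worker p).guarantee hs
  -- A property of some worker after the step is one of the stepping worker or of another one.
  have hex : ∀ {A : Worker V → Prop}, (A w' ∨ ∃ q, q ≠ p ∧ A (W q)) →
      ∃ q, A (Function.update W p w' q) := by
    rintro A (hA | ⟨q, hq, hA⟩)
    · exact ⟨p, by simpa using hA⟩
    · exact ⟨q, by simpa [hq] using hA⟩
  refine ⟨h.memory.step hs (h.worker p), fun q => ?_, fun q r hqr => ?_, fun u hu => ?_,
    fun v hv => ?_, fun v hv => ?_⟩
  · obtain rfl | hq := eq_or_ne q p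
    · simpa using (h.worker q).step hs h.memory
    · simpa [hq] using (h.worker p).interference g (h.worker q) (h.compatible p q hq.symm)
  · obtain rfl | hq := eq_or_ne q p
    · simpa [hqr.symm] using (h.compatible q r hqr).step g (h.worker q) (h.worker r)
    · obtain rfl | hr := eq_or_ne r p
      · simpa [hq] using ((h.compatible r q hq.symm).step g (h.worker r) (h.worker q)).symm
      · simpa [hq, hr] using h.compatible q r hqr
  · apply hex (A := fun w => w.ctrl.Holds u)
    obtain h1 | ⟨h1, h2⟩ := g.locked u hu
    · exact Or.inl h1
    · obtain ⟨q, hq⟩ := h.locked u h1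
      exact Or.inr ⟨q, by rintro rfl; exact h2 hq, hq⟩
  · have hl : m.status v = Status.live := by
      cases hd : m.status v with
      | live => rfl
      | dead => rw [g.dead v hd] at hv; cases hv
    by_cases hc : (W p).Pending v ∨ ∃ u, v ∈ m.S u
    · exact (g.covered_live v hc hv).imp_left fun h => hex (A := fun w => w.Pending v) (Or.inl h)
    · obtain ⟨hp, hS⟩ := not_or.1 hc
      obtain ⟨q, hq⟩ := (h.live v hl).resolve_right hS
      exact Or.inl (hex (A := fun w => w.Pending v) (Or.inr ⟨q, by rintro rfl; exact hp hq, hq⟩))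
  · by_cases hc : (W p).Owns v ∨ m.status v = Status.live
    · exact (g.covered_dead v hc hv).imp_left fun h => hex (A := fun w => w.Owns v) (Or.inl h)
    · obtain ⟨hp, hl⟩ := not_or.1 hc
      have hd : m.status v = Status.dead := by
        cases hd : m.status v with
        | live => exact absurd hd hl
        | dead => rfl
      obtain ⟨q, hq⟩ | hS := h.dead v hd
      · exact Or.inl (hex (A := fun w => w.Owns v) (Or.inr ⟨q, by rintro rfl; exact hp hq, hq⟩))
      · exact Or.inr (g.support_empty v hd hS)

end

/-! ### The termination measure -/

section

variable {V : Type*} [Fintype V] {G : Digraph V} {m m' : Memory V}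
  {w w' : Worker V} {P : ℕ} {W : Fin P → Worker V}

/-- The contribution of the control point to `Worker.rank`. A successor that `DoPost` has not reached
yet counts `4`, for the four steps that it may cost. An element of the waiting set also counts `4`:
this is more than the difference between `suppLoop` and `whileLoop`, and less than the difference
between `enqueue` and each of the two. -/
def Ctrl.rank : Ctrl V → ℕ
  | idle | finished => 0
  | outerLoop => 1
  | whileLoop => 2
  | removeWrite _ _ _ => 3
  | removeRead _ _ => 4
  | suppLoop _ => 5
  | unlockReturn _ _ _ => 6
  | addWrite _ _ _ _ => 7
  | addRead _ _ _ => 8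
  | enqueue _ _ => 10
  | unlockSelf _ _ => 11
  | kill _ _ => 12
  | lockSelf _ _ => 13
  | scan _ R _ => 14 + 4 * R.card
  | unlockNext _ R _ _ => 15 + 4 * R.card
  | recheck _ R _ _ => 16 + 4 * R.card
  | lockSucc _ R _ _ => 17 + 4 * R.card

/-- The weight of a worker; a vertex still to be visited pays for one execution of `DoPost`. -/
def Worker.rank (w : Worker V) : ℕ :=
  (14 + 4 * Fintype.card V) * w.todo.card + 4 * w.Q.card + w.ctrl.rank

/-- The contribution of one vertex to `Memory.potential`. -/
def vertexPotential (s : Status) (X : Finset V) : ℕ :=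
  match s with
  | Status.live => Fintype.card V + 1
  | Status.dead => X.card

/-- A bound on how many vertices can still be killed or removed from a supporting set. The supporting
set of `u` counts with its size only once `u` is dead, since from then on it does not grow; before,
it counts with the largest possible size. -/
def Memory.potential (m : Memory V) : ℕ :=
  ∑ u, vertexPotential (m.status u) (m.S u)

/-- The termination measure of the parallel phase; a removal from a supporting set pays for the
execution of `DoPost` that follows. -/
def parallelRank (m : Memory V) (W : Fin P → Worker V) : ℕ :=
  (14 + 4 * Fintype.card V) * m.potential + ∑ p, (W p).rank

theorem vertexPotential_le (s : Status) (X : Finset V) :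
    vertexPotential s X ≤ Fintype.card V + 1 := by
  cases s
  · exact le_rfl
  · exact (Finset.card_le_univ X).trans (Nat.le_succ _)

theorem Memory.potential_le (m : Memory V) :
    m.potential ≤ Fintype.card V * (Fintype.card V + 1) := by
  refine (Finset.sum_le_card_nsmul _ _ _ fun u _ => vertexPotential_le _ _).trans ?_
  simp

theorem Memory.potential_congr (h : ∀ u, m'.status u = m.status u)
    (hS : ∀ u, m.status u = Status.dead → m'.S u = m.S u) : m'.potential = m.potential := by
  refine Finset.sum_congr rfl fun u _ => ?_
  rw [h]
  cases hu : m.status u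
  · rfl
  · rw [hS u hu]

variable [DecidableEq V]

/-- The potential changes by the contribution of `v` if `v` is the only vertex that is modified. -/
theorem Memory.potential_eq_of_forall (v : V)
    (h : ∀ u, u ≠ v → m'.status u = m.status u ∧ m'.S u = m.S u) :
    m'.potential + vertexPotential (m.status v) (m.S v) =
      m.potential + vertexPotential (m'.status v) (m'.S v) := by
  unfold Memory.potential
  rw [← Finset.add_sum_erase _ _ (Finset.mem_univ v),
    ← Finset.add_sum_erase (a := v) _ (fun u => vertexPotential (m.status u) (m.S u))
      (Finset.mem_univ v),
    Finset.sum_congr rfl fun u hu => by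
      rw [(h u (Finset.ne_of_mem_erase hu)).1, (h u (Finset.ne_of_mem_erase hu)).2]]
  ring

/-- Every step of a worker other than a failed `CAS` decreases its weight or the potential. -/
theorem WorkerInv.rank_step (h : WorkerStep G m w m' w') (hw : WorkerInv G m w) :
    (m' = m ∧ w' = w) ∨
      (14 + 4 * Fintype.card V) * m'.potential + w'.rank <
        (14 + 4 * Fintype.card V) * m.potential + w.rank := by
  have hpost : ∀ v, (post G v).card ≤ Fintype.card V := fun v => Finset.card_le_univ _
  have hpot : ∀ v b, (m.setLock v b).potential = m.potential := fun _ _ => rfl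
  cases h
  case lockSucc_fail | lockSelf_fail => exact Or.inl ⟨rfl, rfl⟩
  all_goals right
  case outer_next T Q v hv =>
    have h1 := Finset.card_erase_add_one hv
    have h2 := hpost v
    simp only [Worker.rank, Ctrl.rank, ← h1, Finset.card_empty, mul_add]
    omega
  case while_next T Q v hv =>
    have h1 := Finset.card_erase_add_one hv
    simp only [Worker.rank, Ctrl.rank]
    omega
  case remove_write T Q u v X =>
    obtain ⟨hv, rfl⟩ := hw.assertion
    have hd : m.status u = Status.dead := hw.dead u (Or.inr rfl)
    have h1 := Finset.card_erase_add_one hv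
    have h2 := Memory.potential_eq_of_forall (m' := m.setS u ((m.S u).erase v)) (m := m) u
      fun x hx => by simp [Memory.setS, hx]
    simp only [vertexPotential, hd, Memory.setS, Function.update_self] at h2
    have h3 : (m.setS u ((m.S u).erase v)).potential + 1 = m.potential := by
      simp only [Memory.setS]; omega
    have h4 := hpost v
    simp only [Worker.rank, Ctrl.rank, ← h3, mul_add]
    omega
  case add_write T Q v u X k =>
    have hl : m.status u = Status.live := hw.assertion.2.1
    have h1 : (m.setS u (insert v X)).potential = m.potential :=
      Memory.potential_congr (fun _ => rfl) fun x hx => by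
        have : x ≠ u := by rintro rfl; simp [hl] at hx
        simp [Memory.setS, this]
    simp only [Worker.rank, Ctrl.rank, h1]
    omega
  case kill T Q v k =>
    have hl : m.status v = Status.live := hw.live v (Or.inr rfl)
    have h1 := Memory.potential_eq_of_forall (m' := m.setStatus v Status.dead) (m := m) v
      fun x hx => by simp [Memory.setStatus, hx]
    simp only [vertexPotential, hl, Memory.setStatus, Function.update_self] at h1
    have h2 : (m.setStatus v Status.dead).potential ≤ m.potential := by
      have := Finset.card_le_univ (m.S v)
      simp only [Memory.setStatus]; omega
    have h3 := Nat.mul_le_mul_left (14 + 4 * Fintype.card V) h2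
    simp only [Worker.rank, Ctrl.rank]
    omega
  case enqueue T Q v k =>
    have h1 := Finset.card_insert_le v Q
    cases k <;> simp only [Worker.rank, Ctrl.rank, Caller.resume] <;> omega
  case unlock_return k =>
    cases k <;> simp only [Worker.rank, Ctrl.rank, Caller.resume, hpot] <;> omega
  case scan_live R _ _ hu _ | scan_dead R _ _ hu _ =>
    have h1 := Finset.card_erase_add_one hu
    simp only [Worker.rank, Ctrl.rank]
    omega
  all_goals
    simp only [Worker.rank, Ctrl.rank, hpot, Finset.card_empty]
    omega

theorem Inv.rank_step {p : Fin P} (h : Inv G m W) (hs : WorkerStep G m (W p) m' w') :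
    (m' = m ∧ Function.update W p w' = W) ∨
      parallelRank m' (Function.update W p w') < parallelRank m W := by
  refine ((h.worker p).rank_step hs).imp (fun ⟨h1, h2⟩ => ⟨h1, by simp [h2]⟩) fun hlt => ?_
  have h1 : ∑ q, (Function.update W p w' q).rank + (W p).rank = ∑ q, (W q).rank + w'.rank := by
    rw [← Finset.add_sum_erase _ _ (Finset.mem_univ p),
      ← Finset.add_sum_erase (a := p) _ (fun q => (W q).rank) (Finset.mem_univ p),
      Finset.sum_congr rfl fun q hq => by
        rw [Function.update_of_ne (Finset.ne_of_mem_erase hq)]]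
    simp only [Function.update_self]
    ring
  unfold parallelRank
  omega

end

/-! ### The whole algorithm -/

section

variable {V : Type*} [Fintype V] {G : Digraph V} {P : ℕ}

/-- The invariant of the whole algorithm. -/
def Config.Inv (G : Digraph V) (c : Config V P) : Prop :=
  match c.main with
  | MainCtrl.init T => (∀ p, c.worker p = ⟨∅, ∅, Ctrl.idle⟩) ∧
      ∀ v, v ∉ T → c.mem.S v = ∅ ∧ c.mem.status v = Status.live ∧ c.mem.lock v = false
  | MainCtrl.join => AC6.Inv G c.mem c.worker
  | MainCtrl.done => AC6.Inv G c.mem c.worker ∧ ∀ p, (c.worker p).ctrl = Ctrl.finished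

/-- The termination measure of the whole algorithm. The initial phase weighs more than any state in
which the workers can be started. -/
def Config.rank (c : Config V P) : ℕ :=
  match c.main with
  | MainCtrl.init T => (14 + 4 * Fintype.card V) * (Fintype.card V * (Fintype.card V + 1)) +
      P * ((14 + 4 * Fintype.card V) * Fintype.card V + 1) + 2 + T.card
  | MainCtrl.join => parallelRank c.mem c.worker + 1
  | MainCtrl.done => 0

theorem parallelRank_fork_le (m : Memory V) (part : V → Fin P) :
    parallelRank m (fun p => ⟨Finset.univ.filter (fun v => part v = p), ∅, Ctrl.outerLoop⟩) ≤
      (14 + 4 * Fintype.card V) * (Fintype.card V * (Fintype.card V + 1)) +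
        P * ((14 + 4 * Fintype.card V) * Fintype.card V + 1) := by
  refine add_le_add (Nat.mul_le_mul_left _ m.potential_le) ?_
  refine (Finset.sum_le_card_nsmul _ _ ((14 + 4 * Fintype.card V) * Fintype.card V + 1)
    fun p _ => ?_).trans (by simp)
  have := Nat.mul_le_mul_left (14 + 4 * Fintype.card V)
    (Finset.card_le_univ (Finset.univ.filter fun v => part v = p))
  simpa [Worker.rank, Ctrl.rank] using this

variable [DecidableEq V] {m m' : Memory V} {w w' : Worker V}

theorem WorkerStep.ctrl_ne (h : WorkerStep G m w m' w') :
    w.ctrl ≠ Ctrl.idle ∧ w.ctrl ≠ Ctrl.finished := by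
  cases h <;> simp

theorem exists_workerStep (h : w.ctrl ≠ Ctrl.idle) (h' : w.ctrl ≠ Ctrl.finished)
    (m : Memory V) : ∃ m' w', WorkerStep G m w m' w' := by
  obtain ⟨T, Q, c⟩ := w
  cases c with
  | idle => exact absurd rfl h
  | finished => exact absurd rfl h'
  | outerLoop =>
    obtain rfl | ⟨v, hv⟩ := T.eq_empty_or_nonempty
    · exact ⟨_, _, .outer_exit m Q⟩
    · exact ⟨_, _, .outer_next m T Q v hv⟩
  | whileLoop =>
    obtain rfl | ⟨v, hv⟩ := Q.eq_empty_or_nonempty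
    · exact ⟨_, _, .while_exit m T⟩
    · exact ⟨_, _, .while_next m T Q v hv⟩
  | suppLoop u =>
    obtain hS | ⟨v, hv⟩ := (m.S u).eq_empty_or_nonempty
    · exact ⟨_, _, .supp_exit m T Q u hS⟩
    · exact ⟨_, _, .supp_next m T Q u v hv⟩
  | removeRead u v => exact ⟨_, _, .remove_read m T Q u v⟩
  | removeWrite u v X => exact ⟨_, _, .remove_write m T Q u v X⟩
  | scan v R k =>
    obtain rfl | ⟨u, hu⟩ := R.eq_empty_or_nonempty
    · exact ⟨_, _, .scan_exit m T Q v k⟩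
    · cases hs : m.status u
      · exact ⟨_, _, .scan_live m T Q v R u k hu hs⟩
      · exact ⟨_, _, .scan_dead m T Q v R u k hu hs⟩
  | lockSucc v R u k =>
    cases hl : m.lock u
    · exact ⟨_, _, .lockSucc_ok m T Q v R u k hl⟩
    · exact ⟨_, _, .lockSucc_fail m T Q v R u k hl⟩
  | recheck v R u k =>
    cases hs : m.status u
    · exact ⟨_, _, .recheck_live m T Q v R u k hs⟩
    · exact ⟨_, _, .recheck_dead m T Q v R u k hs⟩
  | addRead v u k => exact ⟨_, _, .add_read m T Q v u k⟩
  | addWrite v u X k => exact ⟨_, _, .add_write m T Q v u X k⟩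
  | unlockReturn v u k => exact ⟨_, _, .unlock_return m T Q v u k⟩
  | unlockNext v R u k => exact ⟨_, _, .unlock_next m T Q v R u k⟩
  | lockSelf v k =>
    cases hl : m.lock v
    · exact ⟨_, _, .lockSelf_ok m T Q v k hl⟩
    · exact ⟨_, _, .lockSelf_fail m T Q v k hl⟩
  | kill v k => exact ⟨_, _, .kill m T Q v k⟩
  | unlockSelf v k => exact ⟨_, _, .unlock_self m T Q v k⟩
  | enqueue v k => exact ⟨_, _, .enqueue m T Q v k⟩

/-- Only a worker that waits for a lock, and holds none, can make a step that changes nothing. -/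
theorem WorkerStep.of_stutter (h : WorkerStep G m w m w) :
    (∃ u, m.lock u = true) ∧ ∀ u, ¬ w.ctrl.Holds u := by
  have key : ∀ m' w', WorkerStep G m w m' w' → w' = w →
      (∃ u, m.lock u = true) ∧ ∀ u, ¬ w.ctrl.Holds u := by
    intro m' w' h hw
    cases h
    case lockSucc_fail hb | lockSelf_fail hb => exact ⟨⟨_, hb⟩, fun _ => id⟩
    case unlock_return k | enqueue k => cases k <;> simp [Caller.resume] at hw
    case scan_dead hu _ =>
      simp only [Worker.mk.injEq, Ctrl.scan.injEq, Finset.erase_eq_self] at hw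
      exact absurd hu hw.2.2.2.1
    all_goals simp at hw
  exact key m w h rfl

theorem Config.Inv.step {c c' : Config V P} {t : Thread P} (hc : c.Inv G) (h : Step G t c c') :
    c'.Inv G ∧ (c' = c ∨ c'.rank < c.rank) := by
  cases h with
  | init_next m W T v hv =>
    refine ⟨⟨hc.1, fun u hu => ?_⟩, Or.inr ?_⟩
    · obtain rfl | huv := eq_or_ne u v
      · simp [Memory.setS, Memory.setStatus, Memory.setLock]
      · simpa [Memory.setS, Memory.setStatus, Memory.setLock, huv] using
          hc.2 u fun h => hu (Finset.mem_erase.2 ⟨huv, h⟩)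
    · have := Finset.card_erase_lt_of_mem hv
      simp only [Config.rank]
      omega
  | fork m W part =>
    have h0 : ∀ v, m.S v = ∅ ∧ m.status v = Status.live ∧ m.lock v = false :=
      fun v => hc.2 v (Finset.notMem_empty v)
    refine ⟨Inv.fork (fun v => (h0 v).1) (fun v => (h0 v).2.1) (fun v => (h0 v).2.2), Or.inr ?_⟩
    have := parallelRank_fork_le m part
    simp only [Config.rank]
    omega
  | join m W hW => exact ⟨⟨hc, hW⟩, Or.inr (by simp [Config.rank])⟩
  | work m m' mc W p w' h =>
    cases mc with
    | init T => exact absurd (congrArg Worker.ctrl (hc.1 p)) h.ctrl_ne.1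
    | done => exact absurd (hc.2 p) h.ctrl_ne.2
    | join =>
      refine ⟨AC6.Inv.step hc h, (AC6.Inv.rank_step hc h).imp ?_ ?_⟩
      · rintro ⟨rfl, hW⟩
        rw [hW]
      · intro hlt
        simpa [Config.rank] using hlt

/-- Deadlock freedom: before termination, some thread is able to make a step, and all its steps
change the state. If a lock is taken, its holder is such a thread. -/
theorem Config.Inv.exists_enabled {c : Config V P} (hc : c.Inv G) (hP : 0 < P)
    (ht : ¬ c.Terminated) : ∃ t, Enabled G t c ∧ ¬ Step G t c c := by
  obtain ⟨m, mc, W⟩ := c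
  cases mc with
  | done => exact absurd rfl ht
  | init T =>
    have key : ∀ d, Step G none (⟨m, MainCtrl.init T, W⟩ : Config V P) d →
        d.main ≠ MainCtrl.init T := by
      intro d h
      cases h with
      | init_next _ _ _ v hv => simpa using hv
      | fork => simp
    refine ⟨none, ?_, fun h => key _ h rfl⟩
    obtain rfl | ⟨v, hv⟩ := T.eq_empty_or_nonempty
    · exact ⟨_, .fork m W fun _ => ⟨0, hP⟩⟩
    · exact ⟨_, .init_next m W T v hv⟩
  | join =>
    by_cases hf : ∀ p, (W p).ctrl = Ctrl.finished
    · exact ⟨none, ⟨_, .join m W hf⟩, nofun⟩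
    · have hI : AC6.Inv G m W := hc
      obtain ⟨p, hp, hp'⟩ : ∃ p, (W p).ctrl ≠ Ctrl.finished ∧ ¬ WorkerStep G m (W p) m (W p) := by
        by_cases hl : ∃ u, m.lock u = true
        · obtain ⟨u, hu⟩ := hl
          obtain ⟨p, hp⟩ := hI.locked u hu
          exact ⟨p, fun h => by simp [h, Ctrl.Holds] at hp, fun h => h.of_stutter.2 u hp⟩
        · obtain ⟨p, hp⟩ := not_forall.1 hf
          exact ⟨p, hp, fun h => hl h.of_stutter.1⟩
      have hidle : (W p).ctrl ≠ Ctrl.idle := fun h => by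
        simpa [h, Ctrl.Assertion] using (hI.worker p).assertion
      obtain ⟨m', w', hs⟩ := exists_workerStep (G := G) hidle hp m
      refine ⟨some p, ⟨_, .work m m' _ W p w' hs⟩, fun h => hp' ?_⟩
      have key : ∀ d, Step G (some p) (⟨m, MainCtrl.join, W⟩ : Config V P) d →
          WorkerStep G m (W p) d.mem (d.worker p) := by
        intro d h
        cases h with
        | work _ _ _ _ _ w' h => simpa using h
      exact key _ h

variable {σ : ℕ → Thread P} {c : ℕ → Config V P}

theorem IsRun.inv (h : IsRun G σ c) (i : ℕ) : (c i).Inv G := by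
  induction i with
  | zero =>
    obtain ⟨h1, h2⟩ := h.1
    simp [Config.Inv, h1, h2]
  | succ i ih =>
    obtain hs | ⟨-, hs⟩ := h.2 i
    · exact (ih.step hs).1
    · rwa [hs]

theorem IsRun.rank_succ (h : IsRun G σ c) (i : ℕ) :
    c (i + 1) = c i ∨ (c (i + 1)).rank < (c i).rank := by
  obtain hs | ⟨-, hs⟩ := h.2 i
  · exact ((h.inv i).step hs).2
  · exact Or.inl hs

theorem IsRun.eventually_const (h : IsRun G σ c) : ∃ i, ∀ j, i ≤ j → c j = c i := by
  -- Take an index at which the rank is least.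
  obtain ⟨i, hi⟩ : ∃ i, ∀ j, (c i).rank ≤ (c j).rank := by
    obtain ⟨_, ⟨i, rfl⟩, hi⟩ := WellFounded.has_min wellFounded_lt
      (Set.range fun i => (c i).rank) ⟨_, 0, rfl⟩
    exact ⟨i, fun j => not_lt.1 (hi _ ⟨j, rfl⟩)⟩
  refine ⟨i, fun j hj => ?_⟩
  induction j, hj using Nat.le_induction with
  | base => rfl
  | succ j _ ih =>
    refine ((h.rank_succ j).resolve_right fun hlt => ?_).trans ih
    rw [ih] at hlt
    exact absurd (hi (j + 1)) (not_le.2 hlt)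

end

end AC6

theorem mainTheorem1 {V : Type*} [Fintype V] [DecidableEq V] (G : Digraph V) (P : ℕ) (hP : 0 < P)
    (σ : ℕ → AC6.Thread P) (c : ℕ → AC6.Config V P) (hrun : AC6.IsRun G σ c) :
    (AC6.WeaklyFair G σ c → ∃ i, (c i).Terminated) ∧
      (∀ i, (c i).Terminated →
        AC6.Sound G (c i).mem.status ∧ AC6.Complete G (c i).mem.status) := by
  refine ⟨fun hfair => ?_, fun i hi => ?_⟩
  · obtain ⟨i, hi⟩ := hrun.eventually_const
    by_contra! hterm
    obtain ⟨t, hen, hne⟩ := (hrun.inv i).exists_enabled hP (hterm i)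
    obtain ⟨j, hj, hσ⟩ := hfair t i
    have hcj := hi j hj
    have hcj' := hi (j + 1) (hj.trans j.le_succ)
    rw [hcj] at hσ
    have hσ := hσ.resolve_right (not_not_intro hen)
    have hs := hrun.2 j
    rw [hcj, hcj', hσ] at hs
    exact hs.elim hne fun h => h.1 hen
  · have h := hrun.inv i
    unfold AC6.Config.Terminated at hi
    simp only [AC6.Config.Inv, hi] at h
    exact ⟨h.1.memory.sound, h.1.complete h.2⟩
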